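/- **Theorem (Relative characterization).** Let $K$ be an arbitrary set and let $\Lambda$ be a restorative similarity type, i.e. a subset of the set of six unary connectives $\{\smile,\ \frown,\ \circ_\smile,\ \circ_\frown,\ \bullet_\smile,\ \bullet_\frown\}$. Let $\mathcal L_\Lambda$ be the set of formulas $$\phi ::= p_k \mid \top \mid \bot \mid \phi\wedge\phi \mid \phi\vee\phi \mid \star\phi \qquad (k\in K,\ \star\in\Lambda).$$ The Kripke signature has a binary predicate symbol $\mathbf R$ and a unary predicate symbol $\mathbf P_k$ for each $k\in K$; its (nonempty) first-order structures are the Kripke models $\mathfrak M=\langle W,R,\{P_k\}_{k\in K}\rangle$. The standard translation $\mathrm{st}(x,\phi)$ of $\phi\in\mathcal L_\Lambda$ is the first-order formula (with equality) in the free variable $x$ given by $\mathrm{st}(x,p_k)=\mathbf P_kx$, $\mathrm{st}(x,\top)=(x=x)$, $\mathrm{st}(x,\bot)=\neg(x=x)$, $\mathrm{st}(x,\phi\wedge\psi)=\mathrm{st}(x,\phi)\wedge\mathrm{st}(x,\psi)$, $\mathrm{st}(x,\phi\vee\psi)=\mathrm{st}(x,\phi)\vee\mathrm{st}(x,\psi)$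 and, with $y$ a fresh variable, $$\begin{aligned} \mathrm{st}(x,\smile\phi)&=\exists y(x\mathbf Ry\wedge\neg\,\mathrm{st}(y,\phi)), & \mathrm{st}(x,\frown\phi)&=\forall y(x\mathbf Ry\to\neg\,\mathrm{st}(y,\phi)),\\ \mathrm{st}(x,\circ_\smile\phi)&=\neg\,\mathrm{st}(x,\phi)\vee\forall y(x\mathbf Ry\to\mathrm{st}(y,\phi)), & \mathrm{st}(x,\circ_\frown\phi)&=\mathrm{st}(x,\phi)\vee\forall y(x\mathbf Ry\to\neg\,\mathrm{st}(y,\phi)),\\ \mathrm{st}(x,\bullet_\smile\phi)&=\mathrm{st}(x,\phi)\wedge\exists y(x\mathbf Ry\wedge\neg\,\mathrm{st}(y,\phi)), & \mathrm{st}(x,\bullet_\frown\phi)&=\neg\,\mathrm{st}(x,\phi)\wedge\exists y(x\mathbf Ry\wedge\mathrm{st}(y,\phi)). \end{aligned}$$ A $\Lambda$-simulation on a Kripke model $\langle W,R,\{P_k\}_{k\in K}\rangle$ is a relation $S\subseteq W\times W$ such that $wSv$ and $w\in P_k$ imply $v\in P_k$ for every $k\in K$, and such that the following condition holds for each connective belonging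 to $\Lambda$ (for all $w,v,s,t\in W$): * $\smile$: if $wSv$ and $wRs$, then there is $t$ with $vRt$ and $tSs$; * $\frown$: if $wSv$ and $vRt$, then there is $s$ with $wRs$ and $tSs$; * $\circ_\smile$: if $wSv$ and $vRt$, then either $vSt$, or both $vSw$ and there is $s$ with $wRs$ and $sSt$; * $\circ_\frown$: if $wSv$ and $vRt$, then either $tSv$, or there is $s$ with $wRs$ and $tSs$; * $\bullet_\smile$: if $wSv$ and $wRs$, then either $wSs$, or there is $t$ with $vRt$ and $tSs$; * $\bullet_\frown$: if $wSv$ and $wRs$, then either $sSw$, or both $vSw$ and there is $t$ with $vRt$ and $sSt$. A $\Lambda$-simulation between Kripke models $\mathfrak M$ and $\mathfrak M'$ is a $\Lambda$-simulation on their disjoint union $\mathfrak M\uplus\mathfrak M'$. A first-order formula $\alpha(x)$ over the Kripke signature in one free variable $x$ is preserved by $\Lambda$-simulations if, for all Kripke models $\mathfrak M,\mathfrak M'$, every $\Lambda$-simulation $S$ between them, and all worlds $w$ of $\mathfrak M$ and $w'$ of $\mathfrak M'$ with $(w,w')\in S$ (as elements of the disjoint union), $\mathfrak M\Vdash\alpha(x)[w]$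 implies $\mathfrak M'\Vdash\alpha(x)[w']$. Let $\alpha(x)$ be a first-order formula over the Kripke signature in one free variable $x$. Then there is a formula $\phi\in\mathcal L_\Lambda$ such that $\alpha(x)$ and $\mathrm{st}(x,\phi)$ are logically equivalent (satisfied by the same worlds in all Kripke models) if and only if $\alpha(x)$ is preserved by $\Lambda$-simulations. -/

import Mathlib

universe u v

namespace Restorative

open FirstOrder FirstOrder.Language

/-- The six unary connectives: the two subclassical negations `smile` (⌣) and `frown` (⌢), and the
four restoration modalities, written with a white (`circ`) or a black (`bullet`) circle above
a smile or a frown. -/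
inductive Conn : Type
  | smile
  | frown
  | circSmile
  | circFrown
  | bulletSmile
  | bulletFrown

/-- The language `L_Λ` over the propositional letters `p_k` (`k : K`), for a restorative
similarity type `Λ`, that is, a set of the six connectives. -/
inductive ModalFormula (K : Type u) (Λ : Set Conn) : Type u
  | letter (k : K) : ModalFormula K Λ
  | top : ModalFormula K Λ
  | bot : ModalFormula K Λ
  | and (φ ψ : ModalFormula K Λ) : ModalFormula K Λ
  | or (φ ψ : ModalFormula K Λ) : ModalFormula K Λ
  | app (c : Conn) (hc : c ∈ Λ) (φ : ModalFormula K Λ) : ModalFormula K Λ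

/-- Kripke models with a nonempty set of worlds, an accessibility relation `Rel`, and a truth set
`Val k` for every propositional letter. -/
structure KripkeModel (K : Type u) where
  World : Type v
  nonempty : Nonempty World
  Rel : World → World → Prop
  Val : K → World → Prop

namespace KripkeModel

/-- The disjoint union of two Kripke models. -/
def disjUnion {K : Type u} (M N : KripkeModel.{u, v} K) : KripkeModel.{u, v} K where
  World := M.World ⊕ N.World
  nonempty := M.nonempty.map Sum.inl
  Rel
    | Sum.inl w, Sum.inl v => M.Rel w v
    | Sum.inr w, Sum.inr v => N.Rel w v
    | _, _ => False
  Val k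
    | Sum.inl w => M.Val k w
    | Sum.inr w => N.Val k w

end KripkeModel

/-- `S` is a `Λ`-simulation on the single Kripke model `M`. -/
structure IsSimulation {K : Type u} (Λ : Set Conn) (M : KripkeModel.{u, v} K)
    (S : M.World → M.World → Prop) : Prop where
  letter : ∀ k w v, S w v → M.Val k w → M.Val k v
  smile : Conn.smile ∈ Λ → ∀ w v s, S w v → M.Rel w s → ∃ t, M.Rel v t ∧ S t s
  frown : Conn.frown ∈ Λ → ∀ w v t, S w v → M.Rel v t → ∃ s, M.Rel w s ∧ S t s
  circSmile : Conn.circSmile ∈ Λ → ∀ w v t, S w v → M.Rel v t →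
    S v t ∨ (S v w ∧ ∃ s, M.Rel w s ∧ S s t)
  circFrown : Conn.circFrown ∈ Λ → ∀ w v t, S w v → M.Rel v t →
    S t v ∨ ∃ s, M.Rel w s ∧ S t s
  bulletSmile : Conn.bulletSmile ∈ Λ → ∀ w v s, S w v → M.Rel w s →
    S w s ∨ ∃ t, M.Rel v t ∧ S t s
  bulletFrown : Conn.bulletFrown ∈ Λ → ∀ w v s, S w v → M.Rel w s →
    S s w ∨ (S v w ∧ ∃ t, M.Rel v t ∧ S s t)

/-- A `Λ`-simulation between two Kripke models is a `Λ`-simulation on their disjoint union. -/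
def IsSimulationBetween {K : Type u} (Λ : Set Conn) (M N : KripkeModel.{u, v} K)
    (S : (M.disjUnion N).World → (M.disjUnion N).World → Prop) : Prop :=
  IsSimulation Λ (M.disjUnion N) S

/-- Relation symbols of the Kripke signature: a binary symbol `acc` and unary symbols `pred k`. -/
inductive KripkeRelation (K : Type u) : ℕ → Type u
  | acc : KripkeRelation K 2
  | pred (k : K) : KripkeRelation K 1

/-- The Kripke signature. -/
def kripkeLanguage (K : Type u) : FirstOrder.Language.{0, u} where
  Functions := fun _ => Empty
  Relations := KripkeRelation K

/-- The binary relation symbol of the Kripke signature. -/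
def accSymbol {K : Type u} : (kripkeLanguage K).Relations 2 := KripkeRelation.acc

/-- The unary relation symbols of the Kripke signature. -/
def predSymbol {K : Type u} (k : K) : (kripkeLanguage K).Relations 1 := KripkeRelation.pred k

/-- The first-order structure given by a Kripke model. -/
instance KripkeModel.toStructure {K : Type u} (M : KripkeModel.{u, v} K) :
    (kripkeLanguage K).Structure M.World where
  funMap := fun f _ => Empty.elim f
  RelMap := fun r xs =>
    match r, xs with
    | KripkeRelation.acc, xs => M.Rel (xs 0) (xs 1)
    | KripkeRelation.pred k, xs => M.Val k (xs 0)

/-- The atomic formula `x R y`. -/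
def accFormula {K : Type u} {V : Type} {n : ℕ} (x y : V ⊕ Fin n) :
    (kripkeLanguage K).BoundedFormula V n :=
  accSymbol.boundedFormula₂ (Term.var x) (Term.var y)

/-- The atomic formula `P_k x`. -/
def predFormula {K : Type u} {V : Type} {n : ℕ} (k : K) (x : V ⊕ Fin n) :
    (kripkeLanguage K).BoundedFormula V n :=
  (predSymbol k).boundedFormula₁ (Term.var x)

/-- The formula `x = x`. -/
def eqSelf {K : Type u} {V : Type} {n : ℕ} (x : V ⊕ Fin n) :
    (kripkeLanguage K).BoundedFormula V n :=
  Term.bdEqual (Term.var x) (Term.var x)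

/-- A variable, seen under one more quantifier. -/
def weaken {V : Type} {n : ℕ} : V ⊕ Fin n → V ⊕ Fin (n + 1) :=
  Sum.map id Fin.castSucc

/-- The variable bound by the innermost quantifier. -/
def fresh {V : Type} {n : ℕ} : V ⊕ Fin (n + 1) :=
  Sum.inr (Fin.last n)

/-- The standard translation `ST(x, φ)`. The variable `x` is either a free variable, in `V`, or one
of the `n` variables bound so far. -/
def st {K : Type u} {Λ : Set Conn} {V : Type} :
    {n : ℕ} → V ⊕ Fin n → ModalFormula K Λ → (kripkeLanguage K).BoundedFormula V n
  | _, x, .letter k => predFormula k x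
  | _, x, .top => eqSelf x
  | _, x, .bot => ∼(eqSelf x)
  | _, x, .and φ ψ => st x φ ⊓ st x ψ
  | _, x, .or φ ψ => st x φ ⊔ st x ψ
  | _, x, .app .smile _ φ => ∃' (accFormula (weaken x) fresh ⊓ ∼(st fresh φ))
  | _, x, .app .frown _ φ => ∀' (accFormula (weaken x) fresh ⟹ ∼(st fresh φ))
  | _, x, .app .circSmile _ φ =>
      ∼(st x φ) ⊔ ∀' (accFormula (weaken x) fresh ⟹ st fresh φ)
  | _, x, .app .circFrown _ φ =>
      st x φ ⊔ ∀' (accFormula (weaken x) fresh ⟹ ∼(st fresh φ))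
  | _, x, .app .bulletSmile _ φ =>
      st x φ ⊓ ∃' (accFormula (weaken x) fresh ⊓ ∼(st fresh φ))
  | _, x, .app .bulletFrown _ φ =>
      ∼(st x φ) ⊓ ∃' (accFormula (weaken x) fresh ⊓ st fresh φ)

/-- `M ⊩ α(x)[w]`, for a first-order formula `α` in one free variable. -/
def Holds {K : Type u} (M : KripkeModel.{u, v} K) (α : (kripkeLanguage K).Formula Unit)
    (w : M.World) : Prop :=
  α.Realize (fun _ : Unit => w)

/-- Logical equivalence of two first-order formulas in one free variable. -/
def Equivalent {K : Type u} (α β : (kripkeLanguage K).Formula Unit) : Prop :=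
  ∀ (M : KripkeModel.{u, v} K) (w : M.World), Holds M α w ↔ Holds M β w

/-- `α` is preserved by `Λ`-simulations between Kripke models. -/
def PreservedBySimulations {K : Type u} (Λ : Set Conn) (α : (kripkeLanguage K).Formula Unit) :
    Prop :=
  ∀ (M N : KripkeModel.{u, v} K) (S : (M.disjUnion N).World → (M.disjUnion N).World → Prop),
    IsSimulationBetween Λ M N S →
      ∀ (w : M.World) (w' : N.World), S (Sum.inl w) (Sum.inr w') → Holds M α w → Holds N α w'

end Restorative

/-! Truth of `L_Λ`-formulas travels along every simulation, by induction on the formula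
(`IsSimulation.sat`), and disjoint unions do not affect it; this gives one direction.

For the converse, classical negation is not among the connectives, so theories are compared by
inclusion rather than equality. By compactness, a preserved `α` is equivalent to a finite
conjunction of its modal consequences once these jointly entail it. Given a world `w'` satisfying
them all, compactness again yields a world `w` satisfying `α` whose modal theory is included in that
of `w'`. Both models extend to modally saturated ones with the same first-order truths at the chosen
worlds (`exists_isModallySaturated`), obtained as limits of countable chains of ultrapowers. On the
disjoint union of the extensions, theory inclusion is a simulation
(`IsModallySaturated.isSimulation_theoryLE`), so preservation carries `α` across and back down to
`w'`. -/

namespace FirstOrder.Language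

open Filter Structure

universe w

/-! ### Ultrapowers realizing types, and compactness -/

section Ultrapower

variable {L : Language.{u, v}}

/-- An ultrafilter on the finite subsets of `J` containing every cone `{s | j ∈ s}`. -/
theorem exists_ultrafilter_finset (J : Type*) :
    ∃ U : Ultrafilter (Finset J), ∀ j, ∀ᶠ s in (U : Filter (Finset J)), j ∈ s := by
  classical
  refine ⟨Ultrafilter.of atTop, fun j => Ultrafilter.of_le atTop ?_⟩
  filter_upwards [eventually_ge_atTop {j}] with s hs
  exact hs (Finset.mem_singleton_self j)

/-- The diagonal embedding into an ultrapower. -/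
noncomputable def diagonalUltrapower {I : Type*} (U : Ultrafilter I) (M : Type*)
    [L.Structure M] [Nonempty M] : M ↪ₑ[L] (U : Filter I).Product (fun _ => M) where
  toFun a := ((fun _ => a : I → M) : (U : Filter I).Product (fun _ => M))
  map_formula' n φ x := by
    have h := Ultraproduct.realize_formula_cast (M := fun _ : I => M) (u := U) φ
      (fun i _ => x i)
    rw [eventually_const] at h
    exact h

/-- `RealizesTypesOver L f` says that every set of formulas over one parameter from `M` which is
finitely satisfiable in `M` is realized in `N`. -/
def RealizesTypesOver (L : Language.{u, v}) {M N : Type*} [L.Structure M] [L.Structure N]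
    (f : M → N) : Prop :=
  ∀ (a : M) (p : Set (L.Formula (Fin 2))),
    (∀ s : Finset (L.Formula (Fin 2)), ↑s ⊆ p → ∃ b : M, ∀ β ∈ s, β.Realize ![a, b]) →
      ∃ b : N, ∀ β ∈ p, β.Realize ![f a, b]

/-- A single ultrapower, indexed by finite sets of formulas, serves all parameters and types. For a
given `p`, the value at `s` satisfies `s ∩ p`; the cone of each `β ∈ p` then makes `β` hold almost
everywhere. The index set is small enough to stay in the universe of `M`, so the construction can be
iterated. -/
theorem exists_realizesTypesOver (M : Type max u v w) [L.Structure M] [Nonempty M] :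
    ∃ (N : Type max u v w) (_ : L.Structure N) (f : M ↪ₑ[L] N),
      RealizesTypesOver L f := by
  classical
  obtain ⟨U, hU⟩ := exists_ultrafilter_finset (L.Formula (Fin 2))
  refine ⟨(U : Filter (Finset (L.Formula (Fin 2)))).Product (fun _ => M), Ultraproduct.structure,
    diagonalUltrapower (L := L) U M, ?_⟩
  intro a p hp
  have h : ∀ s : Finset (L.Formula (Fin 2)), ∃ b : M,
      ∀ β ∈ s, β ∈ p → β.Realize ![a, b] := fun s => by
    obtain ⟨b, hb⟩ := hp (s.filter (· ∈ p)) (by intro β; simp)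
    exact ⟨b, fun β hβ hβp => hb β (by simp [hβ, hβp])⟩
  choose g hg using h
  refine ⟨(g : (U : Filter (Finset (L.Formula (Fin 2)))).Product (fun _ => M)), fun β hβ => ?_⟩
  have key := Ultraproduct.realize_formula_cast (M := fun _ : Finset (L.Formula (Fin 2)) => M)
    (u := U) β ![fun _ => a, g]
  have e1 : (fun i => ((![fun _ => a, g] i : Finset (L.Formula (Fin 2)) → M) :
      (U : Filter (Finset (L.Formula (Fin 2)))).Product (fun _ => M))) =
      ![diagonalUltrapower (L := L) U M a, (g : (U : Filter (Finset (L.Formula (Fin 2)))).Product (fun _ => M))] := by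
    funext i
    fin_cases i <;> rfl
  rw [e1] at key
  refine key.2 ((hU β).mono fun s hs => ?_)
  convert hg s β hs hβ using 1
  funext i
  fin_cases i <;> rfl

/-- A family of formulas in one free variable is satisfiable as soon as its finite subfamilies
are. -/
theorem exists_realize_of_finset {J : Type*} {α : Type*} (Φ : J → L.Formula α)
    (M : Finset J → Type*) [∀ s, L.Structure (M s)] [∀ s, Nonempty (M s)]
    (x : ∀ s, α → M s) (h : ∀ s, ∀ j ∈ s, (Φ j).Realize (x s)) :
    ∃ (U : Ultrafilter (Finset J)), ∀ j,
      (Φ j).Realize fun i => ((fun s => x s i : ∀ s, M s) : (U : Filter _).Product M) := by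
  obtain ⟨U, hU⟩ := exists_ultrafilter_finset J
  refine ⟨U, fun j => (Ultraproduct.realize_formula_cast (Φ j) fun i s => x s i).2 ?_⟩
  exact (hU j).mono fun s hs => h s j hs

end Ultrapower

/-! ### Elementary chains and their limits -/

section Chain

variable {L : Language.{u, v}}

theorem natLERec_realize {G : ℕ → Type*} [∀ i, L.Structure (G i)]
    (f : ∀ n, G n ↪ₑ[L] G (n + 1)) {m n : ℕ} (h : m ≤ n) {α : Type*} {k : ℕ}
    (φ : L.BoundedFormula α k) (x : α → G m) (y : Fin k → G m) :
    φ.Realize (DirectedSystem.natLERec (fun n => (f n).toEmbedding) m n h ∘ x)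
      (DirectedSystem.natLERec (fun n => (f n).toEmbedding) m n h ∘ y) ↔ φ.Realize x y := by
  induction n, h using Nat.le_induction with
  | base =>
    have : ⇑(DirectedSystem.natLERec (fun n => (f n).toEmbedding) m m le_rfl) = id := by
      rw [DirectedSystem.coe_natLERec]
      funext a
      exact Nat.leRecOn_self a
    rw [this]
    rfl
  | succ n h ih =>
    have : ⇑(DirectedSystem.natLERec (fun n => (f n).toEmbedding) m (n + 1) (h.trans n.le_succ)) =
        f n ∘ DirectedSystem.natLERec (fun n => (f n).toEmbedding) m n h := by
      funext a
      simp only [DirectedSystem.coe_natLERec, Function.comp_apply]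
      exact Nat.leRecOn_succ h a
    rw [this, Function.comp_assoc, Function.comp_assoc, (f n).map_boundedFormula]
    exact ih

/-- Tarski's elementary chain theorem. Only the quantifier needs elementarity of the transition
maps: a limit element may appear only at a later stage `l`, so the universal statement is first
moved from `i` to `l`. -/
theorem DirectLimit.realize_of {ι : Type*} [Preorder ι] [IsDirectedOrder ι] [Nonempty ι]
    {G : ι → Type*} [∀ i, L.Structure (G i)]
    (f : ∀ i j, i ≤ j → G i ↪[L] G j) [DirectedSystem G fun i j h => f i j h]
    (hf : ∀ i j (h : i ≤ j) {α : Type} {k : ℕ} (φ : L.BoundedFormula α k) (x : α → G i)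
      (y : Fin k → G i), φ.Realize (f i j h ∘ x) (f i j h ∘ y) ↔ φ.Realize x y)
    {α : Type} {k : ℕ} (φ : L.BoundedFormula α k) (i : ι) (x : α → G i) (y : Fin k → G i) :
    φ.Realize (DirectLimit.of L ι G f i ∘ x) (DirectLimit.of L ι G f i ∘ y) ↔
      φ.Realize x y := by
  induction φ generalizing i with
  | falsum => rfl
  | equal t₁ t₂ =>
    simp only [BoundedFormula.Realize, ← Sum.comp_elim, HomClass.realize_term]
    exact (DirectLimit.of L ι G f i).injective.eq_iff
  | rel R ts =>
    simp only [BoundedFormula.Realize, ← Sum.comp_elim, HomClass.realize_term]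
    exact (DirectLimit.of L ι G f i).map_rel R _
  | imp φ ψ ih₁ ih₂ => simp only [BoundedFormula.Realize, ih₁, ih₂]
  | all φ ih =>
    simp only [BoundedFormula.Realize]
    constructor
    · intro h a
      rw [← ih i, Fin.comp_snoc]
      exact h _
    · intro h z
      obtain ⟨j, a, rfl⟩ := DirectLimit.exists_of z
      obtain ⟨l, hil, hjl⟩ := directed_of (· ≤ ·) i j
      have e : ∀ {β : Type} (c : β → G i), DirectLimit.of L ι G f i ∘ c =
          DirectLimit.of L ι G f l ∘ (f i l hil ∘ c) := fun c => by
        funext b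
        exact (DirectLimit.of_f (hij := hil)).symm
      rw [e, e, ← DirectLimit.of_f (hij := hjl), ← Fin.comp_snoc, ih l]
      exact (hf i l hil φ.all x y).2 h _

/-- The formula saying that the free variable, as a first argument, has a second argument
satisfying all the formulas in `s`. -/
noncomputable def existsFormula (s : Finset (L.Formula (Fin 2))) : L.Formula Unit :=
  Formula.iExs Unit (Formula.iInf fun β : s =>
    Formula.relabel ![Sum.inl (), Sum.inr ()] β.1)

theorem realize_existsFormula {M : Type*} [L.Structure M] (s : Finset (L.Formula (Fin 2)))
    (a : M) :
    (existsFormula s).Realize (fun _ => a) ↔ ∃ b : M, ∀ β ∈ s, β.Realize ![a, b] := by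
  have e : ∀ i : Unit → M, Sum.elim (fun _ => a) i ∘ ![Sum.inl (), Sum.inr ()] = ![a, i ()] :=
    fun i => by
      funext k
      fin_cases k <;> rfl
  simp only [existsFormula, Formula.realize_iExs, Formula.realize_iInf, Formula.realize_relabel, e,
    Subtype.forall]
  exact ⟨fun ⟨i, hi⟩ => ⟨i (), hi⟩, fun ⟨b, hb⟩ => ⟨fun _ => b, hb⟩⟩

/-- Every structure has an elementary extension realizing all the types over one parameter. -/
theorem exists_elementaryEmbedding_realizesTypesOver_id (M : Type max u v w) [L.Structure M]
    [Nonempty M] :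
    ∃ (N : Type max u v w) (_ : L.Structure N) (f : M → N),
      (∀ (φ : L.Formula Unit) (a : M), φ.Realize (fun _ => f a) ↔ φ.Realize fun _ => a) ∧
        RealizesTypesOver L (id : N → N) := by
  have step : ∀ A : CategoryTheory.Bundled.{max u v w} L.Structure, Nonempty A →
      ∃ (B : CategoryTheory.Bundled.{max u v w} L.Structure) (f : A ↪ₑ[L] B),
        RealizesTypesOver L f := fun A _ => by
    obtain ⟨N, s, f, hf⟩ := exists_realizesTypesOver.{u, v, w} (L := L) A
    exact ⟨⟨N, s⟩, f, hf⟩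
  choose B g hg using step
  let C : ℕ → {A : CategoryTheory.Bundled.{max u v w} L.Structure // Nonempty A} := fun n =>
    n.rec ⟨⟨M, inferInstance⟩, inferInstance⟩ fun _ A => ⟨B A.1 A.2, A.2.map (g A.1 A.2)⟩
  let G : ℕ → Type max u v w := fun n => (C n).1
  let f : ∀ n, G n ↪ₑ[L] G (n + 1) := fun n => g (C n).1 (C n).2
  have hfn : ∀ n, RealizesTypesOver L (f n) := fun n => hg (C n).1 (C n).2
  let F := DirectedSystem.natLERec fun n => (f n).toEmbedding
  have hlim : ∀ {α : Type} (φ : L.Formula α) (i : ℕ) (x : α → G i),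
      φ.Realize (DirectLimit.of L ℕ G F i ∘ x) ↔ φ.Realize x := fun φ i x => by
    have h := DirectLimit.realize_of (L := L) F
      (fun i j h _ _ φ x y => natLERec_realize f h φ x y) φ i x default
    rw [Subsingleton.elim (DirectLimit.of L ℕ G F i ∘ default) default] at h
    exact h
  refine ⟨DirectLimit G F, inferInstance, DirectLimit.of L ℕ G F 0,
    fun φ a => hlim φ 0 fun _ => a, fun c p hp => ?_⟩
  -- A single parameter already lives at some stage `i`, so its types are realized at stage `i + 1`;
  -- hence a countable chain suffices.
  obtain ⟨i, a, rfl⟩ := DirectLimit.exists_of c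
  have pair : ∀ j (a b : G j), ![DirectLimit.of L ℕ G F j a, DirectLimit.of L ℕ G F j b] =
      DirectLimit.of L ℕ G F j ∘ ![a, b] := fun j a b => by
    funext k
    fin_cases k <;> rfl
  have lift : DirectLimit.of L ℕ G F (i + 1) (f i a) = DirectLimit.of L ℕ G F i a := by
    rw [← DirectLimit.of_f (hij := i.le_succ) (x := a)]
    congr 1
    rw [show F = DirectedSystem.natLERec fun n => (f n).toEmbedding from rfl,
      DirectedSystem.coe_natLERec]
    exact (Nat.leRecOn_succ' (C := G) (next := @fun k => f k) a).symm
  -- Finite satisfiability is only known in the limit. For a finite `s` it is one first-order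
  -- formula about the parameter, hence descends to stage `i`.
  obtain ⟨b, hb⟩ := hfn i a p fun s hs => by
    obtain ⟨d, hd⟩ := hp s hs
    have h := (realize_existsFormula s (DirectLimit.of L ℕ G F i a)).2 ⟨d, hd⟩
    exact (realize_existsFormula s a).1 ((hlim _ i fun _ => a).1 h)
  refine ⟨DirectLimit.of L ℕ G F (i + 1) b, fun β hβ => ?_⟩
  rw [id, ← lift, pair, hlim]
  exact hb β hβ

end Chain

end FirstOrder.Language

namespace Restorative

open FirstOrder FirstOrder.Language

/-! ### Relational semantics and invariance under simulations -/

section Semantics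

variable {K : Type u} {Λ : Set Conn}

/-- The relational semantics of `L_Λ`. -/
def Sat (M : KripkeModel.{u, v} K) : M.World → ModalFormula K Λ → Prop
  | w, .letter k => M.Val k w
  | _, .top => True
  | _, .bot => False
  | w, .and φ ψ => Sat M w φ ∧ Sat M w ψ
  | w, .or φ ψ => Sat M w φ ∨ Sat M w ψ
  | w, .app .smile _ φ => ∃ s, M.Rel w s ∧ ¬ Sat M s φ
  | w, .app .frown _ φ => ∀ s, M.Rel w s → ¬ Sat M s φ
  | w, .app .circSmile _ φ => ¬ Sat M w φ ∨ ∀ s, M.Rel w s → Sat M s φ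
  | w, .app .circFrown _ φ => Sat M w φ ∨ ∀ s, M.Rel w s → ¬ Sat M s φ
  | w, .app .bulletSmile _ φ => Sat M w φ ∧ ∃ s, M.Rel w s ∧ ¬ Sat M s φ
  | w, .app .bulletFrown _ φ => ¬ Sat M w φ ∧ ∃ s, M.Rel w s ∧ Sat M s φ

theorem realize_accFormula (M : KripkeModel.{u, v} K) {V : Type} {n : ℕ} (x y : V ⊕ Fin n)
    (a : V → M.World) (b : Fin n → M.World) :
    (accFormula (K := K) x y).Realize a b ↔ M.Rel (Sum.elim a b x) (Sum.elim a b y) := by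
  rw [accFormula, BoundedFormula.realize_rel₂]
  rfl

theorem realize_predFormula (M : KripkeModel.{u, v} K) {V : Type} {n : ℕ} (k : K)
    (x : V ⊕ Fin n) (a : V → M.World) (b : Fin n → M.World) :
    (predFormula k x).Realize a b ↔ M.Val k (Sum.elim a b x) := by
  rw [predFormula, BoundedFormula.realize_rel₁]
  rfl

theorem elim_weaken {W : Type*} {V : Type} {n : ℕ} (x : V ⊕ Fin n) (a : V → W) (b : Fin n → W)
    (c : W) : Sum.elim a (Fin.snoc b c : Fin (n + 1) → W) (weaken x) = Sum.elim a b x := by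
  cases x <;> simp [weaken]

theorem elim_fresh {W : Type*} {V : Type} {n : ℕ} (a : V → W) (b : Fin n → W) (c : W) :
    Sum.elim a (Fin.snoc b c : Fin (n + 1) → W) (fresh : V ⊕ Fin (n + 1)) = c := by
  simp [fresh]

theorem realize_st (M : KripkeModel.{u, v} K) {V : Type} (φ : ModalFormula K Λ) {n : ℕ}
    (x : V ⊕ Fin n) (a : V → M.World) (b : Fin n → M.World) :
    (st x φ).Realize a b ↔ Sat M (Sum.elim a b x) φ := by
  induction φ generalizing n with
  | letter k => rw [st, realize_predFormula, Sat]
  | top => simp [st, Sat, eqSelf]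
  | bot => simp [st, Sat, eqSelf]
  | and φ ψ ih₁ ih₂ => simp [st, Sat, ih₁, ih₂]
  | or φ ψ ih₁ ih₂ => simp [st, Sat, ih₁, ih₂]
  | app c hc φ ih =>
    cases c <;> simp [st, Sat, ih, realize_accFormula, elim_weaken, elim_fresh]

theorem holds_st (M : KripkeModel.{u, v} K) (φ : ModalFormula K Λ) (w : M.World) :
    Holds M (st (Sum.inl ()) φ) w ↔ Sat M w φ :=
  realize_st M φ _ _ _

theorem sat_inl (M N : KripkeModel.{u, v} K) (φ : ModalFormula K Λ) (w : M.World) :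
    Sat (M.disjUnion N) (Sum.inl w) φ ↔ Sat M w φ := by
  induction φ generalizing w with
  | letter k => rfl
  | top => rfl
  | bot => rfl
  | and φ ψ ih₁ ih₂ => simp only [Sat, ih₁, ih₂]
  | or φ ψ ih₁ ih₂ => simp only [Sat, ih₁, ih₂]
  | app c hc φ ih =>
    have e : ∀ P : (M.disjUnion N).World → Prop, (∃ s, (M.disjUnion N).Rel (Sum.inl w) s ∧ P s) ↔
        ∃ s, M.Rel w s ∧ P (Sum.inl s) := fun P =>
      ⟨fun | ⟨.inl s, h⟩ => ⟨s, h⟩ | ⟨.inr _, h⟩ => h.1.elim, fun ⟨s, h⟩ => ⟨.inl s, h⟩⟩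
    have a : ∀ P : (M.disjUnion N).World → Prop, (∀ s, (M.disjUnion N).Rel (Sum.inl w) s → P s) ↔
        ∀ s, M.Rel w s → P (Sum.inl s) := fun P =>
      ⟨fun h s => h (.inl s), fun h => fun | .inl s => h s | .inr _ => False.elim⟩
    cases c <;> simp only [Sat, ih, e, a]

theorem sat_inr (M N : KripkeModel.{u, v} K) (φ : ModalFormula K Λ) (w : N.World) :
    Sat (M.disjUnion N) (Sum.inr w) φ ↔ Sat N w φ := by
  induction φ generalizing w with
  | letter k => rfl
  | top => rfl
  | bot => rfl
  | and φ ψ ih₁ ih₂ => simp only [Sat, ih₁, ih₂]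
  | or φ ψ ih₁ ih₂ => simp only [Sat, ih₁, ih₂]
  | app c hc φ ih =>
    have e : ∀ P : (M.disjUnion N).World → Prop, (∃ s, (M.disjUnion N).Rel (Sum.inr w) s ∧ P s) ↔
        ∃ s, N.Rel w s ∧ P (Sum.inr s) := fun P =>
      ⟨fun | ⟨.inr s, h⟩ => ⟨s, h⟩ | ⟨.inl _, h⟩ => h.1.elim, fun ⟨s, h⟩ => ⟨.inr s, h⟩⟩
    have a : ∀ P : (M.disjUnion N).World → Prop, (∀ s, (M.disjUnion N).Rel (Sum.inr w) s → P s) ↔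
        ∀ s, N.Rel w s → P (Sum.inr s) := fun P =>
      ⟨fun h s => h (.inr s), fun h => fun | .inr s => h s | .inl _ => False.elim⟩
    cases c <;> simp only [Sat, ih, e, a]

theorem IsSimulation.sat {M : KripkeModel.{u, v} K} {S : M.World → M.World → Prop}
    (hS : IsSimulation Λ M S) (φ : ModalFormula K Λ) {w v : M.World} (hwv : S w v)
    (h : Sat M w φ) : Sat M v φ := by
  induction φ generalizing w v with
  | letter k => exact hS.letter k w v hwv h
  | top => trivial
  | bot => exact h
  | and φ ψ ih₁ ih₂ => exact ⟨ih₁ hwv h.1, ih₂ hwv h.2⟩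
  | or φ ψ ih₁ ih₂ => exact h.imp (ih₁ hwv) (ih₂ hwv)
  | app c hc φ ih =>
    cases c with
    | smile =>
      obtain ⟨s, hs, hφ⟩ := h
      obtain ⟨t, ht, hts⟩ := hS.smile hc w v s hwv hs
      exact ⟨t, ht, fun h => hφ (ih hts h)⟩
    | frown =>
      intro t ht hφ
      obtain ⟨s, hs, hts⟩ := hS.frown hc w v t hwv ht
      exact h s hs (ih hts hφ)
    | circSmile =>
      refine or_iff_not_imp_left.2 fun hv t ht => ?_
      rw [not_not] at hv
      -- In the second case `S v w` brings `φ` back to `w`, which excludes the first disjunct there;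
      -- every successor of `w` then satisfies `φ`, and `S s t` passes it to `t`.
      obtain hvt | ⟨hvw, s, hs, hst⟩ := hS.circSmile hc w v t hwv ht
      · exact ih hvt hv
      · exact ih hst (h.resolve_left (not_not.2 (ih hvw hv)) s hs)
    | circFrown =>
      refine or_iff_not_imp_left.2 fun hv t ht hφ => ?_
      obtain htv | ⟨s, hs, hts⟩ := hS.circFrown hc w v t hwv ht
      · exact hv (ih htv hφ)
      · exact h.resolve_left (fun hw => hv (ih hwv hw)) s hs (ih hts hφ)
    | bulletSmile =>
      obtain ⟨hw, s, hs, hφ⟩ := h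
      refine ⟨ih hwv hw, ?_⟩
      obtain hws | ⟨t, ht, hts⟩ := hS.bulletSmile hc w v s hwv hs
      · exact (hφ (ih hws hw)).elim
      · exact ⟨t, ht, fun h => hφ (ih hts h)⟩
    | bulletFrown =>
      obtain ⟨hw, s, hs, hφ⟩ := h
      obtain hsw | ⟨hvw, t, ht, hst⟩ := hS.bulletFrown hc w v s hwv hs
      · exact (hw (ih hsw hφ)).elim
      · exact ⟨fun hv => hw (ih hvw hv), t, ht, ih hst hφ⟩

theorem exists_conj (s : Finset (ModalFormula K Λ)) :
    ∃ φ : ModalFormula K Λ, ∀ (M : KripkeModel.{u, v} K) (w : M.World),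
      Sat M w φ ↔ ∀ χ ∈ s, Sat M w χ := by
  classical
  induction s using Finset.induction_on with
  | empty => exact ⟨.top, fun M w => by simp [Sat]⟩
  | insert χ s _ ih =>
    obtain ⟨φ, hφ⟩ := ih
    exact ⟨.and χ φ, fun M w => by simp [Sat, hφ]⟩

theorem exists_disj (s : Finset (ModalFormula K Λ)) :
    ∃ φ : ModalFormula K Λ, ∀ (M : KripkeModel.{u, v} K) (w : M.World),
      Sat M w φ ↔ ∃ χ ∈ s, Sat M w χ := by
  classical
  induction s using Finset.induction_on with
  | empty => exact ⟨.bot, fun M w => by simp [Sat]⟩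
  | insert χ s _ ih =>
    obtain ⟨φ, hφ⟩ := ih
    exact ⟨.or χ φ, fun M w => by simp [Sat, hφ]⟩

end Semantics

/-! ### Modal saturation and the simulation of theory inclusion -/

section Saturation

variable {K : Type u} {Λ : Set Conn}

/-- `M` is saturated for `L_Λ`: if every finite part of a set of formulas is verified (falsified) at
some successor of `w`, then a single successor verifies (falsifies) the whole set. -/
structure IsModallySaturated (Λ : Set Conn) (M : KripkeModel.{u, v} K) : Prop where
  pos : ∀ (w : M.World) (T : Set (ModalFormula K Λ)),
    (∀ s : Finset (ModalFormula K Λ), ↑s ⊆ T → ∃ y, M.Rel w y ∧ ∀ χ ∈ s, Sat M y χ) →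
      ∃ y, M.Rel w y ∧ ∀ χ ∈ T, Sat M y χ
  neg : ∀ (w : M.World) (T : Set (ModalFormula K Λ)),
    (∀ s : Finset (ModalFormula K Λ), ↑s ⊆ T → ∃ y, M.Rel w y ∧ ∀ χ ∈ s, ¬ Sat M y χ) →
      ∃ y, M.Rel w y ∧ ∀ χ ∈ T, ¬ Sat M y χ

theorem IsModallySaturated.disjUnion {M N : KripkeModel.{u, v} K} (hM : IsModallySaturated Λ M)
    (hN : IsModallySaturated Λ N) : IsModallySaturated Λ (M.disjUnion N) where
  pos := by
    rintro (w | w) T h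
    · obtain ⟨y, hy, hT⟩ := hM.pos w T fun s hs => by
        obtain ⟨y | y, hy, h⟩ := h s hs
        · exact ⟨y, hy, fun χ hχ => (sat_inl M N χ y).1 (h χ hχ)⟩
        · exact hy.elim
      exact ⟨.inl y, hy, fun χ hχ => (sat_inl M N χ y).2 (hT χ hχ)⟩
    · obtain ⟨y, hy, hT⟩ := hN.pos w T fun s hs => by
        obtain ⟨y | y, hy, h⟩ := h s hs
        · exact hy.elim
        · exact ⟨y, hy, fun χ hχ => (sat_inr M N χ y).1 (h χ hχ)⟩
      exact ⟨.inr y, hy, fun χ hχ => (sat_inr M N χ y).2 (hT χ hχ)⟩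
  neg := by
    rintro (w | w) T h
    · obtain ⟨y, hy, hT⟩ := hM.neg w T fun s hs => by
        obtain ⟨y | y, hy, h⟩ := h s hs
        · exact ⟨y, hy, fun χ hχ => mt (sat_inl M N χ y).2 (h χ hχ)⟩
        · exact hy.elim
      exact ⟨.inl y, hy, fun χ hχ => mt (sat_inl M N χ y).1 (hT χ hχ)⟩
    · obtain ⟨y, hy, hT⟩ := hN.neg w T fun s hs => by
        obtain ⟨y | y, hy, h⟩ := h s hs
        · exact hy.elim
        · exact ⟨y, hy, fun χ hχ => mt (sat_inr M N χ y).2 (h χ hχ)⟩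
      exact ⟨.inr y, hy, fun χ hχ => mt (sat_inr M N χ y).1 (hT χ hχ)⟩

/-- Inclusion of `L_Λ`-theories. -/
def TheoryLE (Λ : Set Conn) (M : KripkeModel.{u, v} K) (w v : M.World) : Prop :=
  ∀ φ : ModalFormula K Λ, Sat M w φ → Sat M v φ

/-- Closure under conjunction turns each finite part of the theory of `t` into one formula; the next
lemma is the dual, with disjunctions of formulas false at `t`. -/
theorem IsModallySaturated.exists_theoryLE_of_sat {M : KripkeModel.{u, v} K}
    (hM : IsModallySaturated Λ M) (w t : M.World)
    (h : ∀ χ : ModalFormula K Λ, Sat M t χ → ∃ s, M.Rel w s ∧ Sat M s χ) :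
    ∃ s, M.Rel w s ∧ TheoryLE Λ M t s := by
  refine hM.pos w {χ | Sat M t χ} fun s hs => ?_
  obtain ⟨φ, hφ⟩ := exists_conj.{u, v} s
  obtain ⟨y, hy, hyφ⟩ := h φ ((hφ M t).2 fun χ hχ => hs hχ)
  exact ⟨y, hy, (hφ M y).1 hyφ⟩

theorem IsModallySaturated.exists_theoryLE_of_not_sat {M : KripkeModel.{u, v} K}
    (hM : IsModallySaturated Λ M) (w t : M.World)
    (h : ∀ χ : ModalFormula K Λ, ¬ Sat M t χ → ∃ s, M.Rel w s ∧ ¬ Sat M s χ) :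
    ∃ s, M.Rel w s ∧ TheoryLE Λ M s t := by
  obtain ⟨y, hy, hT⟩ := hM.neg w {χ | ¬ Sat M t χ} fun s hs => by
    obtain ⟨φ, hφ⟩ := exists_disj.{u, v} s
    obtain ⟨y, hy, hyφ⟩ := h φ fun ht => by
      obtain ⟨χ, hχ, h⟩ := (hφ M t).1 ht
      exact hs hχ h
    exact ⟨y, hy, fun χ hχ h => hyφ ((hφ M y).2 ⟨χ, hχ, h⟩)⟩
  exact ⟨y, hy, fun χ hχ => by_contra fun h => hT χ h hχ⟩

/-- A Hennessy–Milner argument. For the four restoration modalities, failure of the first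
alternative supplies a separating formula `φ`. Joining `φ` to an arbitrary formula by `∧` or `∨`
fixes the local part of the modality, which then gives information about successors. -/
theorem IsModallySaturated.isSimulation_theoryLE {M : KripkeModel.{u, v} K}
    (hM : IsModallySaturated Λ M) : IsSimulation Λ M (TheoryLE Λ M) where
  letter k w v h := h (.letter k)
  smile hc w v s h hs := hM.exists_theoryLE_of_not_sat v s fun χ hχ =>
    h (.app .smile hc χ) ⟨s, hs, hχ⟩
  frown hc w v t h ht := hM.exists_theoryLE_of_sat w t fun χ hχ => by
    by_contra hw
    push Not at hw
    exact h (.app .frown hc χ) hw t ht hχ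
  circSmile hc w v t h ht := by
    refine or_iff_not_imp_left.2 fun hvt => ?_
    simp only [TheoryLE, not_forall] at hvt
    obtain ⟨φ, hφv, hφt⟩ := hvt
    -- Such a `χ` refutes `∘⌣χ` at `v`, hence at `w`. Taking `φ ∧ ψ` for `χ` yields inclusion from
    -- `v` to `w`; taking `φ ∨ χ` yields the successor of `w`.
    have key : ∀ χ : ModalFormula K Λ, Sat M v χ → ¬ Sat M t χ →
        Sat M w χ ∧ ∃ s, M.Rel w s ∧ ¬ Sat M s χ := fun χ hv hχ => by
      by_contra hw
      have hw' : Sat M w (.app .circSmile hc χ) := by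
        simp only [Sat]
        grind
      exact (h _ hw').elim (fun h => h hv) fun h => hχ (h t ht)
    refine ⟨fun ψ hψ => (key (.and φ ψ) ⟨hφv, hψ⟩ fun h => hφt h.1).1.2,
      hM.exists_theoryLE_of_not_sat w t fun χ hχ => ?_⟩
    obtain ⟨s, hs, hsχ⟩ := (key (.or φ χ) (.inl hφv) fun h => h.elim hφt hχ).2
    exact ⟨s, hs, fun h => hsχ (.inr h)⟩
  circFrown hc w v t h ht := by
    refine or_iff_not_imp_left.2 fun htv => ?_
    simp only [TheoryLE, not_forall] at htv
    obtain ⟨φ, hφt, hφv⟩ := htv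
    refine hM.exists_theoryLE_of_sat w t fun χ hχ => ?_
    by_contra hw
    push Not at hw
    exact (h (.app .circFrown hc (.and φ χ)) (.inr fun s hs h => hw s hs h.2)).elim
      (fun h => hφv h.1) fun h => h t ht ⟨hφt, hχ⟩
  bulletSmile hc w v s h hs := by
    refine or_iff_not_imp_left.2 fun hws => ?_
    simp only [TheoryLE, not_forall] at hws
    obtain ⟨φ, hφw, hφs⟩ := hws
    refine hM.exists_theoryLE_of_not_sat v s fun χ hχ => ?_
    obtain ⟨t, ht, htχ⟩ := (h (.app .bulletSmile hc (.or φ χ))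
      ⟨.inl hφw, s, hs, fun h => h.elim hφs hχ⟩).2
    exact ⟨t, ht, fun h => htχ (.inr h)⟩
  bulletFrown hc w v s h hs := by
    refine or_iff_not_imp_left.2 fun hsw => ?_
    simp only [TheoryLE, not_forall] at hsw
    obtain ⟨φ, hφs, hφw⟩ := hsw
    refine ⟨fun ψ hψ => by_contra fun hψw => ?_,
      hM.exists_theoryLE_of_sat v s fun χ hχ => ?_⟩
    · exact (h (.app .bulletFrown hc (.or φ ψ))
        ⟨fun h => h.elim hφw hψw, s, hs, .inl hφs⟩).1 (.inr hψ)
    · obtain ⟨t, ht, htχ⟩ := (h (.app .bulletFrown hc (.and φ χ))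
        ⟨fun h => hφw h.1, s, hs, hφs, hχ⟩).2
      exact ⟨t, ht, htχ.2⟩

end Saturation

end Restorative

namespace Restorative

open FirstOrder FirstOrder.Language

/-- Serves every compactness or saturation argument below: a finite part of one special formula plus
translated modal formulas comes from finitely many modal formulas. -/
theorem exists_finset_of_subset_insert_image {A B : Type*} {b : B} {r : A → B} {T : Set A}
    {s : Finset B} (hs : ↑s ⊆ insert b (r '' T)) :
    ∃ t : Finset A, ↑t ⊆ T ∧ ∀ β ∈ s, β = b ∨ ∃ χ ∈ t, r χ = β := by
  classical
  obtain ⟨t, ht, hst⟩ := Finset.subset_set_image_iff.1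
    (show ((s.erase b : Finset B) : Set B) ⊆ r '' T by
      intro β hβ
      rw [Finset.mem_coe, Finset.mem_erase] at hβ
      exact (hs hβ.2).resolve_left hβ.1)
  refine ⟨t, ht, fun β hβ => or_iff_not_imp_left.2 fun hb => Finset.mem_image.1 ?_⟩
  exact hst ▸ Finset.mem_erase.2 ⟨hb, hβ⟩

/-! ### First-order structures as Kripke models -/

section Models

variable {K : Type u} {Λ : Set Conn}

/-- The Kripke model given by a first-order structure. -/
def KripkeModel.ofStructure (W : Type v) [(kripkeLanguage K).Structure W] [h : Nonempty W] :
    KripkeModel.{u, v} K where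
  World := W
  nonempty := h
  Rel w v := Structure.RelMap (accSymbol (K := K)) ![w, v]
  Val k w := Structure.RelMap (predSymbol k) ![w]

theorem KripkeModel.toStructure_ofStructure (W : Type v) [s : (kripkeLanguage K).Structure W]
    [Nonempty W] : (KripkeModel.ofStructure W : KripkeModel.{u, v} K).toStructure = s := by
  refine Structure.ext (funext fun n => funext fun f => f.elim)
    (funext fun n => funext fun r => funext fun xs => ?_)
  cases r with
  | acc =>
    change @Structure.RelMap (kripkeLanguage K) W s 2 accSymbol ![xs 0, xs 1] =
      @Structure.RelMap (kripkeLanguage K) W s 2 accSymbol xs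
    congr 1
    funext i
    fin_cases i <;> rfl
  | pred k =>
    change @Structure.RelMap (kripkeLanguage K) W s 1 (predSymbol k) ![xs 0] =
      @Structure.RelMap (kripkeLanguage K) W s 1 (predSymbol k) xs
    congr 1
    funext i
    fin_cases i
    rfl

theorem holds_ofStructure (W : Type v) [s : (kripkeLanguage K).Structure W] [Nonempty W]
    (α : (kripkeLanguage K).Formula Unit) (w : W) :
    Holds (KripkeModel.ofStructure W) α w ↔ α.Realize fun _ => w := by
  unfold Holds
  rw [KripkeModel.toStructure_ofStructure]
  rfl

theorem isModallySaturated_ofStructure (W : Type v) [(kripkeLanguage K).Structure W]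
    [Nonempty W] (hW : RealizesTypesOver (kripkeLanguage K) (id : W → W)) :
    IsModallySaturated Λ (KripkeModel.ofStructure W : KripkeModel.{u, v} K) := by
  classical
  -- The type to realize is `w R y` together with all `g χ`, with `w` as sole parameter. Taking `g`
  -- to be the standard translation or its negation gives the two halves of saturation.
  have key : ∀ (w : W) (T : Set (ModalFormula K Λ))
      (g : ModalFormula K Λ → (kripkeLanguage K).Formula Unit),
      (∀ s : Finset (ModalFormula K Λ), ↑s ⊆ T → ∃ y : W,
        Structure.RelMap (accSymbol (K := K)) ![w, y] ∧
          ∀ χ ∈ s, (g χ).Realize fun _ => y) →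
      ∃ y : W, Structure.RelMap (accSymbol (K := K)) ![w, y] ∧
        ∀ χ ∈ T, (g χ).Realize fun _ => y := by
    intro w T g h
    let β₀ : (kripkeLanguage K).Formula (Fin 2) := accSymbol.formula₂ (Term.var 0) (Term.var 1)
    let r : ModalFormula K Λ → (kripkeLanguage K).Formula (Fin 2) := fun χ =>
      (g χ).relabel fun _ => 1
    have hβ₀ : ∀ y : W, β₀.Realize ![w, y] ↔
        Structure.RelMap (accSymbol (K := K)) ![w, y] := fun y => Formula.realize_rel₂
    have hr : ∀ χ (y : W), (r χ).Realize ![w, y] ↔ (g χ).Realize fun _ => y := fun χ y =>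
      Formula.realize_relabel
    obtain ⟨y, hy⟩ := hW w (insert β₀ (r '' T)) fun s hs => by
      obtain ⟨t, ht, hst⟩ := exists_finset_of_subset_insert_image hs
      obtain ⟨y, hy, hyt⟩ := h t ht
      refine ⟨y, fun β hβ => ?_⟩
      obtain rfl | ⟨χ, hχ, rfl⟩ := hst β hβ
      · exact (hβ₀ y).2 hy
      · exact (hr χ y).2 (hyt χ hχ)
    exact ⟨y, (hβ₀ y).1 (hy β₀ (Set.mem_insert _ _)),
      fun χ hχ => (hr χ y).1 (hy _ (Set.mem_insert_of_mem _ ⟨χ, hχ, rfl⟩))⟩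
  have hpos : ∀ (χ : ModalFormula K Λ) (y : W),
      Formula.Realize (L := kripkeLanguage K) (st (Sum.inl ()) χ) (fun _ : Unit => y) ↔
        Sat (KripkeModel.ofStructure W) y χ := fun χ y =>
    (holds_ofStructure W _ y).symm.trans (holds_st (KripkeModel.ofStructure W) χ y)
  constructor
  · intro w T h
    obtain ⟨y, hy, hT⟩ := key w T (fun χ => st (Sum.inl ()) χ) fun s hs => by
      obtain ⟨y, hy, hT⟩ := h s hs
      exact ⟨y, hy, fun χ hχ => (hpos χ y).2 (hT χ hχ)⟩
    exact ⟨y, hy, fun χ hχ => (hpos χ y).1 (hT χ hχ)⟩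
  · intro w T h
    obtain ⟨y, hy, hT⟩ := key w T (fun χ => Formula.not (st (Sum.inl ()) χ)) fun s hs => by
      obtain ⟨y, hy, hT⟩ := h s hs
      exact ⟨y, hy, fun χ hχ => Formula.realize_not.2 (mt (hpos χ y).1 (hT χ hχ))⟩
    exact ⟨y, hy, fun χ hχ => mt (hpos χ y).2 (Formula.realize_not.1 (hT χ hχ))⟩

theorem exists_isModallySaturated (Λ : Set Conn) (M : KripkeModel.{u, max u v} K) (w : M.World) :
    ∃ (N : KripkeModel.{u, max u v} K) (w' : N.World), IsModallySaturated Λ N ∧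
      ∀ α : (kripkeLanguage K).Formula Unit, Holds N α w' ↔ Holds M α w := by
  have := M.nonempty
  obtain ⟨W, s, f, hf, hW⟩ :=
    exists_elementaryEmbedding_realizesTypesOver_id.{0, u, v} (L := kripkeLanguage K) M.World
  have : Nonempty W := ⟨f w⟩
  exact ⟨KripkeModel.ofStructure W, f w, isModallySaturated_ofStructure W hW,
    fun α => (holds_ofStructure W α (f w)).trans (hf α w)⟩

/-- Compactness, for sets of first-order formulas in one free variable. -/
theorem exists_holds_of_finset (p : Set ((kripkeLanguage K).Formula Unit))
    (h : ∀ s : Finset ((kripkeLanguage K).Formula Unit), ↑s ⊆ p →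
      ∃ (M : KripkeModel.{u, max u v} K) (w : M.World), ∀ β ∈ s, Holds M β w) :
    ∃ (M : KripkeModel.{u, max u v} K) (w : M.World), ∀ β ∈ p, Holds M β w := by
  classical
  have h' : ∀ s : Finset p, ∃ (M : KripkeModel.{u, max u v} K) (w : M.World),
      ∀ j ∈ s, Holds M j.1 w := fun s => by
    obtain ⟨M, w, hM⟩ := h (s.map (Function.Embedding.subtype _)) (by simp)
    exact ⟨M, w, fun j hj => hM j.1 (by simpa using hj)⟩
  choose M w hM using h'
  have := fun s => (M s).nonempty
  obtain ⟨U, hU⟩ := exists_realize_of_finset (fun j : p => j.1) (fun s => (M s).World)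
    (fun s _ => w s) hM
  exact ⟨KripkeModel.ofStructure ((U : Filter (Finset p)).Product fun s => (M s).World), _,
    fun β hβ => (holds_ofStructure _ β _).2 (hU ⟨β, hβ⟩)⟩

end Models

/-! ### The characterization theorem -/

section Characterization

variable {K : Type u} {Λ : Set Conn}

theorem preservedBySimulations_of_equivalent {α : (kripkeLanguage K).Formula Unit}
    {φ : ModalFormula K Λ} (h : Equivalent.{u, v} α (st (Sum.inl ()) φ)) :
    PreservedBySimulations.{u, v} Λ α := by
  intro M N S hS w w' hw hα
  have hφ := (holds_st M φ w).1 ((h M w).1 hα)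
  exact (h N w').2 ((holds_st N φ w').2 ((sat_inr M N φ w').1
    (IsSimulation.sat hS φ hw ((sat_inl M N φ w).2 hφ))))

/-- Theory inclusion need not be a simulation on the given models, so the argument detours through
saturated ones, where `α` and all standard translations keep their truth values at the chosen
worlds. -/
theorem PreservedBySimulations.holds_of_theory_subset {α : (kripkeLanguage K).Formula Unit}
    (h : PreservedBySimulations.{u, max u v} Λ α) {M N : KripkeModel.{u, max u v} K}
    {w : M.World} {w' : N.World} (hα : Holds M α w)
    (hw : ∀ φ : ModalFormula K Λ, Sat M w φ → Sat N w' φ) : Holds N α w' := by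
  obtain ⟨M', m, hM', hm⟩ := exists_isModallySaturated.{u, v} Λ M w
  obtain ⟨N', n, hN', hn⟩ := exists_isModallySaturated.{u, v} Λ N w'
  refine (hn α).1 (h M' N' _ (hM'.disjUnion hN').isSimulation_theoryLE m n ?_ ((hm α).2 hα))
  intro φ hφ
  rw [sat_inl, ← holds_st, hm, holds_st] at hφ
  rw [sat_inr, ← holds_st, hn, holds_st]
  exact hw φ hφ

/-- A formula preserved by simulations follows from its modal consequences. -/
theorem PreservedBySimulations.holds_of_consequences {α : (kripkeLanguage K).Formula Unit}
    (h : PreservedBySimulations.{u, max u v} Λ α) (N : KripkeModel.{u, max u v} K)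
    (w' : N.World)
    (hN : ∀ φ : ModalFormula K Λ, (∀ (M : KripkeModel.{u, max u v} K) (w : M.World),
      Holds M α w → Sat M w φ) → Sat N w' φ) : Holds N α w' := by
  classical
  obtain ⟨M, w, hM⟩ := exists_holds_of_finset.{u, v}
    (insert α ((fun φ : ModalFormula K Λ => Formula.not (st (Sum.inl ()) φ)) ''
      {φ | ¬ Sat N w' φ})) fun s hs => by
    obtain ⟨t, ht, hst⟩ := exists_finset_of_subset_insert_image hs
    -- A disjunction of formulas false at `w'` is false at `w'`, hence not a consequence of `α`; a
    -- world satisfying `α` and refuting it refutes every disjunct.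
    obtain ⟨ψ, hψ⟩ := exists_disj.{u, max u v} t
    have hψN : ¬ Sat N w' ψ := fun hs => by
      obtain ⟨χ, hχ, h⟩ := (hψ N w').1 hs
      exact ht hχ h
    have hex := mt (hN ψ) hψN
    push Not at hex
    obtain ⟨M, w, hα, hw⟩ := hex
    refine ⟨M, w, fun β hβ => ?_⟩
    obtain rfl | ⟨χ, hχ, rfl⟩ := hst β hβ
    · exact hα
    · exact Formula.realize_not.2 fun h => hw ((hψ M w).2 ⟨χ, hχ, (holds_st M χ w).1 h⟩)
  refine h.holds_of_theory_subset (hM α (Set.mem_insert _ _)) fun φ hφ => by_contra fun hn => ?_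
  exact Formula.realize_not.1 (hM _ (Set.mem_insert_of_mem _ ⟨φ, hn, rfl⟩))
    ((holds_st M φ w).2 hφ)

theorem PreservedBySimulations.exists_equivalent {α : (kripkeLanguage K).Formula Unit}
    (h : PreservedBySimulations.{u, max u v} Λ α) :
    ∃ φ : ModalFormula K Λ, Equivalent.{u, max u v} α (st (Sum.inl ()) φ) := by
  classical
  let C : Set (ModalFormula K Λ) := {φ | ∀ (M : KripkeModel.{u, max u v} K) (w : M.World),
    Holds M α w → Sat M w φ}
  by_contra hno
  obtain ⟨M, w, hM⟩ := exists_holds_of_finset.{u, v}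
    (insert (Formula.not α) ((fun φ : ModalFormula K Λ =>
      (st (Sum.inl ()) φ : (kripkeLanguage K).Formula Unit)) '' C))
    fun s hs => by
    obtain ⟨t, ht, hst⟩ := exists_finset_of_subset_insert_image hs
    obtain ⟨ψ, hψ⟩ := exists_conj.{u, max u v} t
    by_contra hs
    push Not at hs
    -- If `¬α` were inconsistent with the finite set `t` of consequences, their conjunction `ψ`
    -- would be equivalent to `α`, against `hno`.
    refine hno ⟨ψ, fun M w => ⟨fun hα => (holds_st M ψ w).2 ((hψ M w).2 fun χ hχ =>
      ht hχ M w hα), fun hw => by_contra fun hα => ?_⟩⟩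
    obtain ⟨β, hβ, hn⟩ := hs M w
    obtain rfl | ⟨χ, hχ, rfl⟩ := hst β hβ
    · exact hn (Formula.realize_not.2 hα)
    · exact hn ((holds_st M χ w).2 ((hψ M w).1 ((holds_st M ψ w).1 hw) χ hχ))
  refine Formula.realize_not.1 (hM _ (Set.mem_insert _ _)) (h.holds_of_consequences M w fun φ hφ =>
    (holds_st M φ w).1 (hM _ (Set.mem_insert_of_mem _ ⟨φ, hφ, rfl⟩)))

end Characterization

end Restorative

theorem theorem6p4 {K : Type u} (Λ : Set Restorative.Conn)
    (α : (Restorative.kripkeLanguage K).Formula Unit) :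
    (∃ φ : Restorative.ModalFormula K Λ,
        Restorative.Equivalent.{u, max u v} α (Restorative.st (Sum.inl ()) φ)) ↔
      Restorative.PreservedBySimulations.{u, max u v} Λ α :=
  ⟨fun ⟨_, h⟩ => Restorative.preservedBySimulations_of_equivalent h, fun h => h.exists_equivalent⟩
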